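/- Let $R$ be a commutative ring, $n \ge 0$ and $w \in S_n$. Let $s_i$ be the transposition of $i$ and $i+1$, and $\operatorname{length}$ the Coxeter length with respect to these generators; put $\ell = \operatorname{length}(w)$. Grothendieck polynomials. For $1 \le i \le n-1$ the Demazure operator $\overline{\partial}_i$ sends a polynomial $f$ in $x_1,\dots,x_n$ (and possibly further variables, treated as constants) with coefficients in $R$ to the polynomial $$\overline{\partial}_i f = \frac{x_{i+1} f - x_i\,(s_i\cdot f)}{x_{i+1}-x_i},$$ where $s_i$ interchanges $x_i$ and $x_{i+1}$. Let $w_0 \in S_n$ be the longest permutation. The double Grothendieck polynomials $\mathcal G_w(\mathbf x,\mathbf y) \in R[x_1,\dots,x_n,y_1,\dots,y_n]$ are obtained from $\mathcal G_{w_0}(\mathbf x,\mathbf y) = \prod_{i+j\le n}(1-x_iy_j)$ by the recurrence $\mathcal G_{ws_i} = \overline{\partial}_i\,\mathcal G_w$ whenever $\operatorname{length}(ws_i) < \operatorname{length}(w)$; the single Grothendieck polynomials $\mathcal G_w(\mathbf x) \in R[x_1,\dots,x_n]$ are obtained by the same recurrence from $\mathcal G_{w_0}(\mathbf x) = \prod_{i=1}^n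 (1-x_i)^{n-i}$. Subwords. The square word in $S_{2n}$ is $$Q_{n\times n} = s_n s_{n-1}\cdots s_1\; s_{n+1}s_n\cdots s_2\;\cdots\; s_{2n-1}s_{2n-2}\cdots s_n .$$ Its letters are placed in the $n\times n$ grid, row by row from top to bottom and each row from right to left, so that the box $(i,j)$ carries $s_{i+j-1}$; subwords $P$ of $Q_{n\times n}$ are regarded as subsets of the grid. The Demazure product $\delta(P)$ of a word $P = (\sigma_1,\dots,\sigma_k)$ is defined by $e_{\sigma_1}\cdots e_{\sigma_k} = e_{\delta(P)}$, where $e_\pi e_\sigma = e_{\pi\sigma}$ if $\operatorname{length}(\pi\sigma) > \operatorname{length}(\pi)$ and $e_\pi e_\sigma = e_\pi$ if $\operatorname{length}(\pi\sigma)<\operatorname{length}(\pi)$, for $\sigma$ a simple reflection. Regard $S_n$ as the subgroup of $S_{2n}$ that fixes $n+1,\dots,2n$. Then $\mathcal G_w(\mathbf x,\mathbf y)$ and $\mathcal G_w(\mathbf x)$ are well defined (every $w$ is reached by the recurrence, and the resulting polynomial does not depend on the chain of recurrence steps), and $$\mathcal G_w(\mathbf 1-\mathbf x,\mathbf 1-\mathbf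 y) = \sum_{P\subseteq Q_{n\times n},\ \delta(P)=w} (-1)^{|P|-\ell}\prod_{(i,j)\in P}(x_i+y_j-x_iy_j),$$ $$\mathcal G_w(\mathbf 1-\mathbf x) = \sum_{P\subseteq Q_{n\times n},\ \delta(P)=w} (-1)^{|P|-\ell}\prod_{(i,j)\in P}x_i .$$ -/

import Mathlib

open MvPolynomial

section SymmetricGroup

variable {m : ℕ}

/-- The simple reflection `s_{i+1}` of the symmetric group on `{1, …, m}`: the adjacent transposition
of the letters that have the (zero-based) names `i` and `i + 1`. -/
def simpleReflection (i : Fin (m - 1)) : Equiv.Perm (Fin m) :=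
  Equiv.swap ⟨i.val, by omega⟩ ⟨i.val + 1, by omega⟩

/-- The Coxeter length: the least number of simple reflections in a word with product `w`.
(The simple reflections generate the symmetric group, so the set is never empty.) -/
noncomputable def coxeterLength (w : Equiv.Perm (Fin m)) : ℕ :=
  sInf {k : ℕ | ∃ Q : List (Fin (m - 1)), Q.length = k ∧ (Q.map simpleReflection).prod = w}

/-- The rule `e_π e_σ = e_{πσ}` if `length (πσ) > length π`, and `e_π e_σ = e_π` otherwise, for a
simple reflection `σ`, read on the indices of the basis elements of the Demazure algebra. -/
noncomputable def demazureMul (π : Equiv.Perm (Fin m)) (i : Fin (m - 1)) : Equiv.Perm (Fin m) :=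
  if coxeterLength π < coxeterLength (π * simpleReflection i) then π * simpleReflection i else π

/-- The Demazure product `δ(Q)` of a word `Q = (σ_1, …, σ_k)` in the simple reflections, that is
the index in `e_{σ_1} ⋯ e_{σ_k} = e_{δ(Q)}`; the product is evaluated from left to right, starting
from the unit `e_1`. -/
noncomputable def demazureProduct (Q : List (Fin (m - 1))) : Equiv.Perm (Fin m) :=
  Q.foldl demazureMul 1

end SymmetricGroup

section SquareWord

variable {n : ℕ}

/-- The standard embedding of `S_n` in `S_{2n}`, as the permutations that fix `n + 1, …, 2n`. -/
def embedPerm (w : Equiv.Perm (Fin n)) : Equiv.Perm (Fin (n + n)) :=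
  finSumFinEquiv.permCongr (Equiv.Perm.sumCongr w 1)

/-- The letter of the square word at a place of the `n × n` grid: the box in row `i` and column `j`
(counted from one) carries `s_{i+j-1}`. -/
def squareLetter (p : Fin n × Fin n) : Fin (n + n - 1) :=
  ⟨p.1.val + p.2.val, by omega⟩

/-- The boxes of the `n × n` grid in the order of the square word: rows from top to bottom, each row
from right to left. -/
def squareOrder (n : ℕ) : List (Fin n × Fin n) :=
  (List.finRange n).flatMap fun i => (List.finRange n).reverse.map fun j => (i, j)

/-- The square word `s_n ⋯ s_1 s_{n+1} ⋯ s_2 ⋯ s_{2n-1} ⋯ s_n`, restricted to the boxes in `P`. -/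
def squareSubword (P : Finset (Fin n × Fin n)) : List (Fin (n + n - 1)) :=
  ((squareOrder n).filter fun p => p ∈ P).map squareLetter

/-- The subwords of the square word (as sets of boxes of the grid) with Demazure product `w`. -/
noncomputable def subwordsWithProduct (w : Equiv.Perm (Fin n)) :
    Finset (Finset (Fin n × Fin n)) :=
  Finset.univ.filter fun P => demazureProduct (squareSubword P) = embedPerm w

end SquareWord

section DemazureOperator

variable {R σ : Type*} [CommRing R] [DecidableEq σ]

theorem sub_dvd_sub_rename_swap (a b : σ) (f : MvPolynomial σ R) :
    (X b - X a : MvPolynomial σ R) ∣ f - rename (Equiv.swap a b) f := by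
  induction f using MvPolynomial.induction_on with
  | C r => simp
  | add p q hp hq =>
    have h := dvd_add hp hq
    rw [map_add]
    convert h using 1
    ring
  | mul_X p k hp =>
    have hk : (X b - X a : MvPolynomial σ R) ∣ X k - X (Equiv.swap a b k) := by
      by_cases h1 : k = a
      · subst h1
        rw [Equiv.swap_apply_left]
        exact ⟨-1, by ring⟩
      · by_cases h2 : k = b
        · subst h2
          rw [Equiv.swap_apply_right]
        · rw [Equiv.swap_apply_of_ne_of_ne h1 h2]
          simp
    rw [map_mul, rename_X]
    have h := dvd_add (hp.mul_right (X k)) (hk.mul_left (rename (Equiv.swap a b) p))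
    convert h using 1
    ring

theorem exists_demazure_quotient (a b : σ) (f : MvPolynomial σ R) :
    ∃ g : MvPolynomial σ R,
      (X b - X a) * g = X b * f - X a * rename (Equiv.swap a b) f := by
  obtain ⟨c, hc⟩ := sub_dvd_sub_rename_swap a b f
  refine ⟨f + X a * c, ?_⟩
  linear_combination (-X a) * hc

/-- The Demazure operator in the two variables `x_a`, `x_b`: the quotient of
`x_b f - x_a (s · f)` by `x_b - x_a`, where `s` interchanges the two variables. -/
noncomputable def demazureOperator (a b : σ) (f : MvPolynomial σ R) : MvPolynomial σ R :=
  (exists_demazure_quotient a b f).choose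

theorem demazureOperator_spec (a b : σ) (f : MvPolynomial σ R) :
    (X b - X a) * demazureOperator a b f = X b * f - X a * rename (Equiv.swap a b) f :=
  (exists_demazure_quotient a b f).choose_spec

/-- The quotient that defines the Demazure operator is unique. -/
theorem eq_demazureOperator {a b : σ} (hab : a ≠ b) {f g : MvPolynomial σ R}
    (h : (X b - X a) * g = X b * f - X a * rename (Equiv.swap a b) f) :
    g = demazureOperator a b f := by
  rw [← demazureOperator_spec] at h
  generalize demazureOperator a b f = g' at h
  let φ : MvPolynomial σ R →ₐ[R] MvPolynomial σ R :=
    aeval fun k => if k = b then X b + X a else X k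
  let ψ : MvPolynomial σ R →ₐ[R] MvPolynomial σ R :=
    aeval fun k => if k = b then X b - X a else X k
  have hψφ : ∀ p, ψ (φ p) = p := by
    have : ψ.comp φ = AlgHom.id R _ := by
      ext1 k
      by_cases hk : k = b
      · subst hk
        simp [φ, ψ, hab]
      · simp [φ, ψ, hk]
    intro p
    exact DFunLike.congr_fun this p
  have hφ : φ (X b - X a) = X b := by simp [φ, hab]
  have h2 := congrArg φ h
  rw [map_mul, map_mul, hφ] at h2
  have h3 : φ g = φ g' := by
    have := congrArg (fun p => p.divMonomial (Finsupp.single b 1)) h2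
    simpa [MvPolynomial.X_mul_divMonomial] using this
  rw [← hψφ g, h3, hψφ]

end DemazureOperator

/-- The substitution `v ↦ 1 - v` in every variable. -/
noncomputable def oneMinus {R σ : Type*} [CommRing R] (f : MvPolynomial σ R) : MvPolynomial σ R :=
  aeval (fun v => 1 - X v) f

section Grothendieck

variable {R σ : Type*} [CommRing R] [DecidableEq σ] {n : ℕ}

/-- The `i`-th Demazure operator on polynomials in which `x 0, x 1, …` name the variables
`x_1, x_2, …` (all other variables are treated as constants). -/
noncomputable def demazureAt (x : Fin n → σ) (i : Fin (n - 1)) (f : MvPolynomial σ R) :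
    MvPolynomial σ R :=
  demazureOperator (x ⟨i.val, by omega⟩) (x ⟨i.val + 1, by omega⟩) f

/-- `DemazureDescent x top w f`: the polynomial `f` is obtained for `w ∈ S_n` from the polynomial
`top` for the longest permutation `w_0` by applications of the recurrence
`G_{w s_i} = (i-th Demazure operator) G_w` for `length (w s_i) < length w`. -/
inductive DemazureDescent (x : Fin n → σ) (top : MvPolynomial σ R) :
    Equiv.Perm (Fin n) → MvPolynomial σ R → Prop
  | top : DemazureDescent x top Fin.revPerm top
  | step (w : Equiv.Perm (Fin n)) (f : MvPolynomial σ R) (i : Fin (n - 1))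
      (hi : coxeterLength (w * simpleReflection i) < coxeterLength w)
      (hf : DemazureDescent x top w f) :
      DemazureDescent x top (w * simpleReflection i) (demazureAt x i f)

/-- `G` is the Grothendieck polynomial `G_w(x)`: it is obtained by the recurrence from
`G_{w_0}(x) = ∏ (1 - x_i)^{n-i}`. -/
def IsGrothendieck (w : Equiv.Perm (Fin n)) (G : MvPolynomial (Fin n) R) : Prop :=
  DemazureDescent (fun i => i) (∏ i : Fin n, (1 - X i) ^ (n - (i.val + 1))) w G

/-- `G` is the double Grothendieck polynomial `G_w(x, y)`: it is obtained by the same recurrence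
(in the variables `x_i = X (Sum.inl i)`) from `G_{w_0}(x, y) = ∏_{i+j ≤ n} (1 - x_i y_j)`,
where `y_j = X (Sum.inr j)`. -/
def IsDoubleGrothendieck (w : Equiv.Perm (Fin n)) (G : MvPolynomial (Fin n ⊕ Fin n) R) : Prop :=
  DemazureDescent Sum.inl
    (∏ p : Fin n × Fin n with (p.1.val + 1) + (p.2.val + 1) ≤ n,
      (1 - X (Sum.inl p.1) * X (Sum.inr p.2))) w G

end Grothendieck

/-!
Independence of the chain of recurrence steps is not proved through the braid relations of the
Demazure operators. Instead, every polynomial that the recurrence produces for `w` is shown to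
equal the explicit sum over subwords after the substitution `v ↦ 1 - v`
(`eq_oneMinus_subwordSum_of_demazureDescent`); since that substitution is an involution, this gives
the formula and uniqueness at once. Existence only needs that a permutation without ascents is the
longest one (`exists_demazureDescent`). The single polynomials are the case `y = 0`.

The sum over subwords is the coefficient of `w`, up to the sign `(-1) ^ length w`, in a product over
the grid of factors `1 - (x_i + y_j - x_i y_j) e_{i+j-1}` in the Demazure algebra of `S_n`, where
the generators beyond those of `S_n` are put equal to zero (`subwordSum_eq_gridProduct`). The
algebra enters through its action on functions on `S_n` (`demazureDual`); its relations follow from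
the description of Demazure multiplication by `s_i` as sorting the values at two adjacent positions
into descending order (`demazureMul_apply`), which in turn rests on length being the number of
inversions. Subwords with a letter outside `S_n` do not contribute, because their Demazure product
never lies in `S_n` (`foldl_demazureMul_ne_embedPerm`).

The Yang–Baxter relation (`boxFactor_mul_boxFactor_mul_exchangeFactor`) shows that multiplying the
grid product on the right by `(1 - x_i) - (x_{i+1} - x_i) e_i` exchanges `x_i` and `x_{i+1}`, up to
the scalar `1 - x_i` (`gridProduct_mul_exchangeFactor`). The coefficient of `w` in this identity,
for `length (w s_i) < length w`, is the recurrence of Grothendieck polynomials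
(`sub_mul_subwordSum_mul_simpleReflection`).

For the longest permutation, a subword lies in the staircase `i + j ≤ n` and has at least as many
letters as the staircase has boxes, so the staircase is the only candidate. That it does occur
follows from the recurrence itself: otherwise all the sums would vanish, but the one for the
identity has constant term one (`subwordsWithProduct_revPerm`).
-/

/-! ### Length, inversions and the Demazure product -/

section Inversions

variable {m : ℕ}

/-- The smaller of the two positions that `simpleReflection i` interchanges. -/
def lowerPos (i : Fin (m - 1)) : Fin m := ⟨i.val, by omega⟩

/-- The larger of the two positions that `simpleReflection i` interchanges. -/
def upperPos (i : Fin (m - 1)) : Fin m := ⟨i.val + 1, by omega⟩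

theorem simpleReflection_eq_swap (i : Fin (m - 1)) :
    simpleReflection i = Equiv.swap (lowerPos i) (upperPos i) := rfl

theorem lowerPos_lt_upperPos (i : Fin (m - 1)) : lowerPos i < upperPos i := by
  simp [lowerPos, upperPos]

theorem lowerPos_ne_upperPos (i : Fin (m - 1)) : lowerPos i ≠ upperPos i :=
  (lowerPos_lt_upperPos i).ne

theorem mul_simpleReflection_lowerPos (w : Equiv.Perm (Fin m)) (i : Fin (m - 1)) :
    (w * simpleReflection i) (lowerPos i) = w (upperPos i) := by
  simp [simpleReflection_eq_swap]

theorem mul_simpleReflection_upperPos (w : Equiv.Perm (Fin m)) (i : Fin (m - 1)) :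
    (w * simpleReflection i) (upperPos i) = w (lowerPos i) := by
  simp [simpleReflection_eq_swap]

theorem mul_simpleReflection_mul_self (w : Equiv.Perm (Fin m)) (i : Fin (m - 1)) :
    w * simpleReflection i * simpleReflection i = w := by
  rw [mul_assoc, simpleReflection_eq_swap, Equiv.swap_mul_self, mul_one]

/-- The inversions of a permutation, as pairs of positions. -/
def inversions (w : Equiv.Perm (Fin m)) : Finset (Fin m × Fin m) :=
  Finset.univ.filter fun p => p.1 < p.2 ∧ w p.2 < w p.1

theorem mem_inversions {w : Equiv.Perm (Fin m)} {p : Fin m × Fin m} :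
    p ∈ inversions w ↔ p.1 < p.2 ∧ w p.2 < w p.1 := by
  simp [inversions]

/-- An adjacent transposition preserves the order of every pair of positions but its own. -/
theorem simpleReflection_lt_iff (i : Fin (m - 1)) {a b : Fin m}
    (h : ¬(a = lowerPos i ∧ b = upperPos i)) (h' : ¬(b = lowerPos i ∧ a = upperPos i)) :
    simpleReflection i a < simpleReflection i b ↔ a < b := by
  simp only [simpleReflection_eq_swap, Equiv.swap_apply_def]
  simp only [lowerPos, upperPos, Fin.ext_iff] at *
  split_ifs <;> simp only [Fin.lt_def] at * <;> omega

theorem card_inversions_mul_simpleReflection {w : Equiv.Perm (Fin m)} {i : Fin (m - 1)}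
    (h : w (lowerPos i) < w (upperPos i)) :
    (inversions (w * simpleReflection i)).card = (inversions w).card + 1 := by
  set s := simpleReflection i with hs
  have hss : ∀ a, s (s a) = a := fun a => by simp [hs, simpleReflection_eq_swap]
  have hlow : s (lowerPos i) = upperPos i := by simp [hs, simpleReflection_eq_swap]
  have hupp : s (upperPos i) = lowerPos i := by simp [hs, simpleReflection_eq_swap]
  have hne := lowerPos_lt_upperPos i
  have key : inversions (w * s) =
      insert (lowerPos i, upperPos i)
        ((inversions w).map (Equiv.prodCongr s s).toEmbedding) := by
    ext ⟨a, b⟩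
    have himg : (a, b) ∈ (inversions w).map (Equiv.prodCongr s s).toEmbedding ↔
        (s a, s b) ∈ inversions w := by
      rw [Finset.mem_map_equiv]
      have : (Equiv.prodCongr s s).symm (a, b) = (s a, s b) := by
        rw [Equiv.symm_apply_eq]; simp [hss]
      rw [this]
    rw [Finset.mem_insert, himg, mem_inversions, mem_inversions, Prod.mk.injEq]
    simp only [Equiv.Perm.mul_apply]
    by_cases h1 : a = lowerPos i ∧ b = upperPos i
    · obtain ⟨rfl, rfl⟩ := h1
      simp [hlow, hupp, h, hne]
    · by_cases h2 : b = lowerPos i ∧ a = upperPos i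
      · obtain ⟨rfl, rfl⟩ := h2
        simp only [hlow, hupp]
        constructor
        · rintro ⟨h3, -⟩
          exact absurd h3 hne.asymm
        · rintro (⟨h3, -⟩ | ⟨-, h3⟩)
          · exact absurd h3 hne.ne'
          · exact absurd h3 h.asymm
      · rw [simpleReflection_lt_iff i h1 h2]
        tauto
  rw [key, Finset.card_insert_of_notMem, Finset.card_map]
  rw [Finset.mem_map_equiv, mem_inversions]
  have : (Equiv.prodCongr s s).symm (lowerPos i, upperPos i) = (upperPos i, lowerPos i) := by
    rw [Equiv.symm_apply_eq]; simp [hlow, hupp]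
  rw [this]
  exact fun h3 => h3.1.asymm hne

theorem card_inversions_mul_simpleReflection_add_one {w : Equiv.Perm (Fin m)} {i : Fin (m - 1)}
    (h : w (upperPos i) < w (lowerPos i)) :
    (inversions (w * simpleReflection i)).card + 1 = (inversions w).card := by
  rw [← card_inversions_mul_simpleReflection (i := i), mul_simpleReflection_mul_self]
  rwa [mul_simpleReflection_lowerPos, mul_simpleReflection_upperPos]

theorem apply_lowerPos_lt_or_gt (w : Equiv.Perm (Fin m)) (i : Fin (m - 1)) :
    w (lowerPos i) < w (upperPos i) ∨ w (upperPos i) < w (lowerPos i) :=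
  lt_or_gt_of_ne fun h => lowerPos_ne_upperPos i (w.injective h)

theorem card_inversions_mul_simpleReflection_le (w : Equiv.Perm (Fin m)) (i : Fin (m - 1)) :
    (inversions (w * simpleReflection i)).card ≤ (inversions w).card + 1 := by
  rcases apply_lowerPos_lt_or_gt w i with h | h
  · exact (card_inversions_mul_simpleReflection h).le
  · have := card_inversions_mul_simpleReflection_add_one h
    omega

theorem eq_one_of_forall_lowerPos_lt {w : Equiv.Perm (Fin m)}
    (h : ∀ i, w (lowerPos i) < w (upperPos i)) : w = 1 := by
  cases m with
  | zero => exact Subsingleton.elim _ _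
  | succ k =>
    have hw : StrictMono w := Fin.strictMono_iff_lt_succ.2 fun i => h i
    have hrange : Set.range w = Set.range (id : Fin (k + 1) → Fin (k + 1)) := by
      rw [w.surjective.range_eq, Set.range_id]
    have := (StrictMono.range_inj hw strictMono_id).1 hrange
    exact Equiv.ext fun a => congrFun this a

theorem eq_revPerm_of_forall_upperPos_lt {w : Equiv.Perm (Fin m)}
    (h : ∀ i, w (upperPos i) < w (lowerPos i)) : w = Fin.revPerm := by
  have h1 : Fin.revPerm * w = 1 :=
    eq_one_of_forall_lowerPos_lt fun i => by simpa using h i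
  ext a
  have := congrArg Fin.rev (Equiv.congr_fun h1 a)
  simpa using congrArg Fin.val this

theorem card_inversions_prod_le (Q : List (Fin (m - 1))) :
    (inversions (Q.map simpleReflection).prod).card ≤ Q.length := by
  induction Q using List.reverseRecOn with
  | nil => simp [inversions, Finset.filter_eq_empty_iff]; intro a b h; exact h.le
  | append_singleton Q i ih =>
    have := card_inversions_mul_simpleReflection_le (Q.map simpleReflection).prod i
    simp only [List.map_append, List.prod_append, List.map_cons, List.map_nil, List.prod_singleton,
      List.length_append, List.length_singleton]
    omega

theorem exists_word_length_eq_card_inversions (w : Equiv.Perm (Fin m)) :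
    ∃ Q : List (Fin (m - 1)), Q.length = (inversions w).card ∧
      (Q.map simpleReflection).prod = w := by
  induction hk : (inversions w).card generalizing w with
  | zero =>
    refine ⟨[], rfl, ?_⟩
    rw [eq_one_of_forall_lowerPos_lt (w := w)]
    · simp
    · intro i
      rcases apply_lowerPos_lt_or_gt w i with h | h
      · exact h
      · have := card_inversions_mul_simpleReflection_add_one h
        omega
  | succ k ih =>
    obtain ⟨i, hi⟩ : ∃ i, w (upperPos i) < w (lowerPos i) := by
      by_contra! hcon
      have h1 : w = 1 := eq_one_of_forall_lowerPos_lt fun i =>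
        (apply_lowerPos_lt_or_gt w i).resolve_right (hcon i).not_gt
      subst h1
      have := card_inversions_prod_le ([] : List (Fin (m - 1)))
      simp at this
      simp [this] at hk
    obtain ⟨Q, hQ, hQw⟩ := ih (w * simpleReflection i) (by
      have := card_inversions_mul_simpleReflection_add_one hi
      omega)
    refine ⟨Q ++ [i], by simp [hQ], ?_⟩
    simp [hQw, mul_simpleReflection_mul_self]

theorem coxeterLength_eq_card_inversions (w : Equiv.Perm (Fin m)) :
    coxeterLength w = (inversions w).card := by
  apply le_antisymm
  · exact Nat.sInf_le (exists_word_length_eq_card_inversions w)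
  · refine le_csInf ⟨_, exists_word_length_eq_card_inversions w⟩ ?_
    rintro k ⟨Q, rfl, rfl⟩
    exact card_inversions_prod_le Q

theorem coxeterLength_lt_mul_simpleReflection_iff (w : Equiv.Perm (Fin m)) (i : Fin (m - 1)) :
    coxeterLength w < coxeterLength (w * simpleReflection i) ↔
      w (lowerPos i) < w (upperPos i) := by
  rw [coxeterLength_eq_card_inversions, coxeterLength_eq_card_inversions]
  rcases apply_lowerPos_lt_or_gt w i with h | h
  · have := card_inversions_mul_simpleReflection h
    exact ⟨fun _ => h, fun _ => by omega⟩
  · have := card_inversions_mul_simpleReflection_add_one h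
    exact ⟨fun _ => by omega, fun h' => absurd h' h.asymm⟩

theorem coxeterLength_mul_simpleReflection_lt_iff (w : Equiv.Perm (Fin m)) (i : Fin (m - 1)) :
    coxeterLength (w * simpleReflection i) < coxeterLength w ↔
      w (upperPos i) < w (lowerPos i) := by
  have := coxeterLength_lt_mul_simpleReflection_iff (w * simpleReflection i) i
  rwa [mul_simpleReflection_mul_self, mul_simpleReflection_lowerPos,
    mul_simpleReflection_upperPos] at this

theorem coxeterLength_eq_mul_simpleReflection_add_one {w : Equiv.Perm (Fin m)} {i : Fin (m - 1)}
    (h : w (upperPos i) < w (lowerPos i)) :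
    coxeterLength w = coxeterLength (w * simpleReflection i) + 1 := by
  rw [coxeterLength_eq_card_inversions, coxeterLength_eq_card_inversions,
    card_inversions_mul_simpleReflection_add_one h]

theorem demazureMul_eq (w : Equiv.Perm (Fin m)) (i : Fin (m - 1)) :
    demazureMul w i =
      if w (lowerPos i) < w (upperPos i) then w * simpleReflection i else w := by
  simp only [demazureMul, coxeterLength_lt_mul_simpleReflection_iff]

theorem demazureMul_of_lt {w : Equiv.Perm (Fin m)} {i : Fin (m - 1)}
    (h : w (lowerPos i) < w (upperPos i)) : demazureMul w i = w * simpleReflection i := by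
  rw [demazureMul_eq, if_pos h]

theorem demazureMul_of_gt {w : Equiv.Perm (Fin m)} {i : Fin (m - 1)}
    (h : w (upperPos i) < w (lowerPos i)) : demazureMul w i = w := by
  rw [demazureMul_eq, if_neg h.asymm]

/-- Demazure multiplication sorts the two adjacent values into descending order. This makes the
relations of the Demazure algebra identities between `max` and `min`. -/
theorem demazureMul_apply (w : Equiv.Perm (Fin m)) (i : Fin (m - 1)) (a : Fin m) :
    demazureMul w i a =
      if a = lowerPos i then max (w (lowerPos i)) (w (upperPos i))
      else if a = upperPos i then min (w (lowerPos i)) (w (upperPos i)) else w a := by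
  have hne := lowerPos_ne_upperPos i
  rcases apply_lowerPos_lt_or_gt w i with h | h
  · rw [demazureMul_of_lt h, max_eq_right h.le, min_eq_left h.le]
    split_ifs with h1 h2
    · rw [h1, mul_simpleReflection_lowerPos]
    · rw [h2, mul_simpleReflection_upperPos]
    · rw [simpleReflection_eq_swap, Equiv.Perm.mul_apply, Equiv.swap_apply_of_ne_of_ne h1 h2]
  · rw [demazureMul_of_gt h, max_eq_left h.le, min_eq_right h.le]
    split_ifs with h1 h2
    · rw [h1]
    · rw [h2]
    · rfl

theorem demazureMul_idem (w : Equiv.Perm (Fin m)) (i : Fin (m - 1)) :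
    demazureMul (demazureMul w i) i = demazureMul w i := by
  ext a
  have hne := lowerPos_ne_upperPos i
  simp only [demazureMul_apply, hne.symm, if_true, if_false]
  split_ifs <;> simp

theorem demazureMul_comm (w : Equiv.Perm (Fin m)) {i j : Fin (m - 1)}
    (hij : i.val + 2 ≤ j.val) :
    demazureMul (demazureMul w i) j = demazureMul (demazureMul w j) i := by
  have h1 : lowerPos i ≠ lowerPos j := by simp [lowerPos]; omega
  have h2 : lowerPos i ≠ upperPos j := by simp [lowerPos, upperPos]; omega
  have h3 : upperPos i ≠ lowerPos j := by simp [lowerPos, upperPos]; omega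
  have h4 : upperPos i ≠ upperPos j := by simp [upperPos]; omega
  ext a
  simp only [demazureMul_apply, h1, h2, h3, h4, h1.symm, h2.symm, h3.symm, h4.symm, if_false]
  split_ifs <;> simp_all

theorem demazureMul_braid (w : Equiv.Perm (Fin m)) {i j : Fin (m - 1)}
    (hij : j.val = i.val + 1) :
    demazureMul (demazureMul (demazureMul w i) j) i =
      demazureMul (demazureMul (demazureMul w j) i) j := by
  have h1 : lowerPos j = upperPos i := by simp [lowerPos, upperPos, hij]
  have h2 : lowerPos i ≠ upperPos i := lowerPos_ne_upperPos i
  have h3 : lowerPos i ≠ upperPos j := by simp [lowerPos, upperPos]; omega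
  have h4 : upperPos i ≠ upperPos j := by simp [upperPos]; omega
  ext a
  simp only [demazureMul_apply, h1, h2, h3, h4, h2.symm, h3.symm, h4.symm, if_false, if_true]
  generalize w (lowerPos i) = x
  generalize w (upperPos i) = y
  generalize w (upperPos j) = z
  congr 1
  split_ifs <;> simp only [max_def, min_def] <;> split_ifs <;> first | rfl | omega

/-- Each letter of a word increases the length of the Demazure product by at most one. -/
theorem coxeterLength_demazureProduct_le (Q : List (Fin (m - 1))) :
    coxeterLength (demazureProduct Q) ≤ Q.length := by
  induction Q using List.reverseRecOn with
  | nil =>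
    have := card_inversions_prod_le ([] : List (Fin (m - 1)))
    simpa [demazureProduct, coxeterLength_eq_card_inversions] using this
  | append_singleton Q i ih =>
    have h : demazureProduct (Q ++ [i]) = demazureMul (demazureProduct Q) i := by
      simp [demazureProduct]
    rw [h, List.length_append, List.length_singleton, demazureMul_eq]
    split_ifs
    · have := card_inversions_mul_simpleReflection_le (demazureProduct Q) i
      simp only [coxeterLength_eq_card_inversions] at *
      omega
    · omega

end Inversions

/-! ### The symmetric group inside a larger one -/

section Embedding

variable {n : ℕ}

theorem embedPerm_castAdd (w : Equiv.Perm (Fin n)) (a : Fin n) :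
    embedPerm w (Fin.castAdd n a) = Fin.castAdd n (w a) := by
  simp [embedPerm, Equiv.permCongr_apply]

theorem embedPerm_natAdd (w : Equiv.Perm (Fin n)) (a : Fin n) :
    embedPerm w (Fin.natAdd n a) = Fin.natAdd n a := by
  simp [embedPerm, Equiv.permCongr_apply, -Fin.natAdd_eq_addNat]

theorem embedPerm_one : embedPerm (1 : Equiv.Perm (Fin n)) = 1 := by
  ext a
  simp [embedPerm, Equiv.permCongr_apply]

theorem embedPerm_injective : Function.Injective (embedPerm (n := n)) := by
  intro v w h
  ext a
  have := Equiv.congr_fun h (Fin.castAdd n a)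
  rw [embedPerm_castAdd, embedPerm_castAdd] at this
  simpa using congrArg Fin.val this

/-- The generator with a given index in the larger group. -/
def castLetter (i : Fin (n - 1)) : Fin (n + n - 1) := ⟨i.val, by omega⟩

theorem lowerPos_castLetter (i : Fin (n - 1)) :
    lowerPos (castLetter i) = Fin.castAdd n (lowerPos i) := rfl

theorem upperPos_castLetter (i : Fin (n - 1)) :
    upperPos (castLetter i) = Fin.castAdd n (upperPos i) := rfl

theorem embedPerm_demazureMul (w : Equiv.Perm (Fin n)) (i : Fin (n - 1)) :
    demazureMul (embedPerm w) (castLetter i) = embedPerm (demazureMul w i) := by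
  ext a
  simp only [demazureMul_apply, lowerPos_castLetter, upperPos_castLetter, embedPerm_castAdd]
  refine Fin.addCases (fun a => ?_) (fun a => ?_) a
  · simp only [embedPerm_castAdd, Fin.castAdd_inj, demazureMul_apply]
    split_ifs <;> simp [Fin.coe_max, Fin.coe_min]
  · have h : ∀ b : Fin n, Fin.natAdd n a ≠ Fin.castAdd n b := fun b h => by
      have := congrArg Fin.val h
      simp at this
      omega
    simp only [embedPerm_natAdd, h, if_false]

variable {m : ℕ}

/-- The permutation does not map the set of positions `0, …, k` to itself. -/
def CrossesAt (k : ℕ) (w : Equiv.Perm (Fin m)) : Prop :=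
  ∃ p : Fin m, p.val ≤ k ∧ k < (w p).val

theorem crossesAt_demazureMul {k : ℕ} {w : Equiv.Perm (Fin m)} (h : CrossesAt k w)
    (i : Fin (m - 1)) : CrossesAt k (demazureMul w i) := by
  obtain ⟨p, hp, hwp⟩ := h
  by_cases h1 : p = lowerPos i
  · refine ⟨lowerPos i, h1 ▸ hp, ?_⟩
    rw [demazureMul_apply, if_pos rfl]
    subst h1
    rw [Fin.coe_max]
    exact lt_max_of_lt_left hwp
  · by_cases h2 : p = upperPos i
    · refine ⟨lowerPos i, ?_, ?_⟩
      · have := lowerPos_lt_upperPos i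
        rw [← h2, Fin.lt_def] at this
        omega
      · rw [demazureMul_apply, if_pos rfl, Fin.coe_max]
        subst h2
        exact lt_max_of_lt_right hwp
    · exact ⟨p, hp, by rwa [demazureMul_apply, if_neg h1, if_neg h2]⟩

/-- If `w` maps the positions `0, …, k` to themselves, then the generator `k` moves a larger value
into position `k`. -/
theorem crossesAt_demazureMul_self (w : Equiv.Perm (Fin m)) (i : Fin (m - 1)) :
    CrossesAt i.val (demazureMul w i) := by
  by_cases h : CrossesAt i.val w
  · exact crossesAt_demazureMul h i
  · refine ⟨lowerPos i, le_rfl, ?_⟩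
    rw [demazureMul_apply, if_pos rfl, Fin.coe_max]
    apply lt_max_of_lt_right
    by_contra! hcon
    -- Otherwise `w` maps the `i + 2` positions `0, …, i + 1` into the `i + 1` values `0, …, i`.
    have hmaps : ∀ p ∈ Finset.Iic (upperPos i), w p ∈ Finset.Iic (lowerPos i) := by
      intro p hp
      rw [Finset.mem_Iic] at *
      rcases hp.eq_or_lt with rfl | hp
      · exact hcon
      · by_contra! hw
        exact h ⟨p, Nat.lt_succ_iff.1 hp, hw⟩
    have := Finset.card_le_card_of_injOn w hmaps w.injective.injOn
    simp [lowerPos, upperPos] at this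

theorem crossesAt_foldl_demazureMul {k : ℕ} {w : Equiv.Perm (Fin m)} (h : CrossesAt k w)
    (Q : List (Fin (m - 1))) : CrossesAt k (Q.foldl demazureMul w) := by
  induction Q generalizing w with
  | nil => exact h
  | cons i Q ih => exact ih (crossesAt_demazureMul h i)

theorem not_crossesAt_embedPerm (w : Equiv.Perm (Fin n)) {k : ℕ} (hk : n ≤ k + 1) :
    ¬CrossesAt k (embedPerm w) := by
  rintro ⟨p, hp, hwp⟩
  induction p using Fin.addCases with
  | left a =>
    rw [embedPerm_castAdd, Fin.val_castAdd] at hwp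
    omega
  | right a =>
    rw [embedPerm_natAdd] at hwp
    omega

end Embedding

/-! ### The Yang–Baxter relation for idempotent braid generators -/

section ZeroHecke

variable {A H : Type*} [CommRing A] [Ring H] [Algebra A H]

/-- The relations between the generators of the Demazure algebra (the `0`-Hecke algebra): they are
idempotent and satisfy the braid relations. -/
structure IsDemazureFamily (e : ℕ → H) : Prop where
  idem : ∀ i, e i * e i = e i
  comm : ∀ i j, i + 2 ≤ j → Commute (e i) (e j)
  braid : ∀ i, e i * e (i + 1) * e i = e (i + 1) * e i * e (i + 1)

/-- The factor `1 - (x + y - x y) e_i` that a box of weight `x + y - x y` contributes. -/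
def boxFactor (e : ℕ → H) (x y : A) (i : ℕ) : H := 1 - (x + y - x * y) • e i

/-- The element `(1 - x) - (x' - x) e_i`; when `1 - x` is a unit, it is `1 - x` times the factor of
the difference of `x'` and `x` under the formal group law `x + y - x y`. -/
def exchangeFactor (e : ℕ → H) (x x' : A) (i : ℕ) : H := algebraMap A H (1 - x) - (x' - x) • e i

/-- The product over a row of `J` boxes, read from right to left, whose first box carries `e_i`. -/
def rowProduct (e : ℕ → H) (x : A) (y : ℕ → A) (i J : ℕ) : H :=
  ((List.range J).reverse.map fun j => boxFactor e x (y j) (i + j)).prod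

/-- The product over the first `k` rows of a grid with `J` columns, in the order of the square
word. -/
def gridProduct (e : ℕ → H) (x y : ℕ → A) (k J : ℕ) : H :=
  ((List.range k).map fun r => rowProduct e (x r) y r J).prod

variable {e : ℕ → H}

theorem boxFactor_mul_boxFactor_mul_exchangeFactor (he : IsDemazureFamily e) (x x' y : A) (i : ℕ) :
    boxFactor e x y i * boxFactor e x' y (i + 1) * exchangeFactor e x x' i =
      exchangeFactor e x x' (i + 1) * boxFactor e x' y i * boxFactor e x y (i + 1) := by
  simp only [boxFactor, exchangeFactor, Algebra.algebraMap_eq_smul_one]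
  have h1 := he.idem i
  have h2 := he.idem (i + 1)
  have h3 := he.braid i
  generalize e i = s at *
  generalize e (i + 1) = t at *
  simp only [sub_mul, mul_sub, smul_mul_assoc, mul_smul_comm, one_mul, mul_one, smul_smul,
    smul_sub, h1, h2, h3]
  module

theorem rowProduct_succ (e : ℕ → H) (x : A) (y : ℕ → A) (i J : ℕ) :
    rowProduct e x y i (J + 1) =
      rowProduct e x (fun j => y (j + 1)) (i + 1) J * boxFactor e x (y 0) i := by
  simp only [rowProduct, List.range_succ_eq_map, List.reverse_cons, List.map_append,
    List.prod_append, ← List.map_reverse, List.map_map, List.map_cons, List.map_nil,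
    List.prod_singleton, add_zero]
  congr 3
  ext j
  simp [add_assoc, add_comm 1]

theorem commute_rowProduct (he : IsDemazureFamily e) (x : A) (y : ℕ → A) {i k : ℕ} (J : ℕ)
    (hik : i + 2 ≤ k) : Commute (e i) (rowProduct e x y k J) := by
  refine Commute.list_prod_right _ _ fun u hu => ?_
  obtain ⟨j, -, rfl⟩ := List.mem_map.1 hu
  exact Commute.sub_right (Commute.one_right _)
    (Commute.smul_right (he.comm i (k + j) (by omega)) _)

/-- Two adjacent rows exchange their parameters at the cost of an exchange factor. The proof slides
that factor along the rows by the Yang–Baxter relation; at the end of the rows it is a scalar,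
because the generators vanish there. -/
theorem rowProduct_mul_rowProduct_mul_exchangeFactor (he : IsDemazureFamily e) (x x' : A)
    (y : ℕ → A) (i J : ℕ) (hvanish : ∀ k, i + J ≤ k → e k = 0) :
    rowProduct e x y i J * rowProduct e x' y (i + 1) J * exchangeFactor e x x' i =
      (1 - x) • (rowProduct e x' y i J * rowProduct e x y (i + 1) J) := by
  induction J generalizing i y with
  | zero =>
    simp [rowProduct, exchangeFactor, hvanish i le_rfl, Algebra.algebraMap_eq_smul_one]
  | succ J ih =>
    have ih' := ih (fun j => y (j + 1)) (i + 1) fun k hk => hvanish k (by omega)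
    have hcomm : ∀ a b : A, Commute (boxFactor e a (y 0) i)
        (rowProduct e b (fun j => y (j + 1)) (i + 2) J) := by
      exact fun a b => Commute.sub_left (Commute.one_left _)
        (Commute.smul_left (commute_rowProduct he b _ J le_rfl) _)
    have hsplit : ∀ a b : A, rowProduct e a y i (J + 1) * rowProduct e b y (i + 1) (J + 1) =
        rowProduct e a (fun j => y (j + 1)) (i + 1) J *
          rowProduct e b (fun j => y (j + 1)) (i + 1 + 1) J *
          (boxFactor e a (y 0) i * boxFactor e b (y 0) (i + 1)) := by
      intro a b
      rw [rowProduct_succ, rowProduct_succ, mul_assoc, ← mul_assoc (boxFactor e a (y 0) i),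
        (hcomm a b).eq]
      simp only [mul_assoc]
    rw [hsplit, hsplit, mul_assoc, boxFactor_mul_boxFactor_mul_exchangeFactor he,
      mul_assoc (exchangeFactor _ _ _ _), ← mul_assoc, ih', smul_mul_assoc]

theorem gridProduct_mul_exchangeFactor (he : IsDemazureFamily e) (x y : ℕ → A) {i k J : ℕ}
    (hi : i + 1 < k) (hvanish : ∀ j, i + J ≤ j → e j = 0) :
    gridProduct e x y k J * exchangeFactor e (x i) (x (i + 1)) i =
      (1 - x i) • gridProduct e (x ∘ Equiv.swap i (i + 1)) y k J := by
  obtain ⟨l, rfl⟩ : ∃ l, k = i + (l + 1 + 1) := ⟨k - i - 2, by omega⟩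
  have hsplit : ∀ x : ℕ → A, gridProduct e x y (i + (l + 1 + 1)) J =
      ((List.range i).map fun r => rowProduct e (x r) y r J).prod *
        (rowProduct e (x i) y i J * rowProduct e (x (i + 1)) y (i + 1) J) *
        ((List.range l).map fun r => rowProduct e (x (i + (r + 2))) y (i + (r + 2)) J).prod := by
    intro x
    simp [gridProduct, List.range_add, List.range_succ_eq_map, mul_assoc, Function.comp_def]
  have hlater : Commute (exchangeFactor e (x i) (x (i + 1)) i)
      ((List.range l).map fun r => rowProduct e (x (i + (r + 2))) y (i + (r + 2)) J).prod := by
    refine Commute.list_prod_right _ _ fun u hu => ?_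
    obtain ⟨r, -, rfl⟩ := List.mem_map.1 hu
    exact Commute.sub_left (Algebra.commute_algebraMap_left _ _)
      (Commute.smul_left (commute_rowProduct he _ _ _ (by omega)) _)
  have hfirst : ((List.range i).map fun r =>
      rowProduct e ((x ∘ Equiv.swap i (i + 1)) r) y r J) =
      (List.range i).map fun r => rowProduct e (x r) y r J := by
    refine List.map_congr_left fun r hr => ?_
    have := List.mem_range.1 hr
    rw [Function.comp_apply, Equiv.swap_apply_of_ne_of_ne (by omega) (by omega)]
  have hlast : ((List.range l).map fun r =>
      rowProduct e ((x ∘ Equiv.swap i (i + 1)) (i + (r + 2))) y (i + (r + 2)) J) =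
      (List.range l).map fun r => rowProduct e (x (i + (r + 2))) y (i + (r + 2)) J := by
    refine List.map_congr_left fun r hr => ?_
    rw [Function.comp_apply, Equiv.swap_apply_of_ne_of_ne (by omega) (by omega)]
  rw [hsplit, hsplit, hfirst, hlast, mul_assoc, ← hlater.eq, ← mul_assoc, mul_assoc _ (_ * _),
    rowProduct_mul_rowProduct_mul_exchangeFactor he _ _ _ _ _ hvanish]
  simp [mul_assoc]

/-- The expansion of a product of factors `1 - a_p f_p` over the subwords of a word. -/
theorem list_prod_one_sub_smul {ι : Type*} [DecidableEq ι] (a : ι → A) (f : ι → H) (L : List ι)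
    (hL : L.Nodup) :
    (L.map fun p => 1 - a p • f p).prod =
      ∑ P ∈ L.toFinset.powerset,
        ((-1) ^ P.card * ∏ p ∈ P, a p) • ((L.filter fun p => p ∈ P).map f).prod := by
  induction L with
  | nil => simp
  | cons q L ih =>
    obtain ⟨hq, hL⟩ := List.nodup_cons.1 hL
    have hq' : q ∉ L.toFinset := by simpa using hq
    rw [List.toFinset_cons, Finset.sum_powerset_insert hq', List.map_cons, List.prod_cons, ih hL,
      sub_mul, one_mul, sub_eq_add_neg, ← neg_mul, Finset.mul_sum]
    congr 1
    · refine Finset.sum_congr rfl fun P hP => ?_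
      have hqP : q ∉ P := fun h => hq' (Finset.mem_powerset.1 hP h)
      simp [hqP]
    · refine Finset.sum_congr rfl fun P hP => ?_
      have hqP : q ∉ P := fun h => hq' (Finset.mem_powerset.1 hP h)
      have hfilter : (L.filter fun p => p ∈ insert q P) = L.filter fun p => p ∈ P := by
        refine List.filter_congr fun p hp => ?_
        have : p ≠ q := fun h => hq (h ▸ hp)
        simp [this]
      rw [List.filter_cons_of_pos (by simp), hfilter, Finset.card_insert_of_notMem hqP,
        Finset.prod_insert hqP, List.map_cons, List.prod_cons, mul_smul_comm, neg_mul,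
        smul_mul_assoc, ← neg_smul, smul_smul]
      congr 1
      ring

end ZeroHecke

/-! ### The Demazure algebra acting on functions on the symmetric group -/

section DemazureDual

variable {A : Type*} [CommRing A] {n : ℕ}

/-- The action of the generators of the Demazure algebra on functions on `S_n` that is dual to
right Demazure multiplication. The letters beyond those of `S_n` act as zero: a word in which
one of them occurs has a Demazure product outside `S_n`. -/
noncomputable def demazureDual (A : Type*) [CommRing A] (n k : ℕ) :
    Module.End A (Equiv.Perm (Fin n) → A) :=
  if h : k < n - 1 then LinearMap.funLeft A A fun v => demazureMul v ⟨k, h⟩ else 0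

theorem demazureDual_apply {k : ℕ} (hk : k < n - 1) (f : Equiv.Perm (Fin n) → A)
    (v : Equiv.Perm (Fin n)) : demazureDual A n k f v = f (demazureMul v ⟨k, hk⟩) := by
  simp [demazureDual, hk, LinearMap.funLeft_apply]

theorem demazureDual_eq_zero {k : ℕ} (hk : n - 1 ≤ k) : demazureDual A n k = 0 := by
  simp [demazureDual, hk.not_gt]

theorem isDemazureFamily_demazureDual (A : Type*) [CommRing A] (n : ℕ) :
    IsDemazureFamily (demazureDual A n) where
  idem i := by
    by_cases hi : i < n - 1
    · refine LinearMap.ext fun f => funext fun v => ?_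
      simp only [Module.End.mul_apply, demazureDual_apply hi, demazureMul_idem]
    · simp [demazureDual_eq_zero (A := A) (not_lt.1 hi)]
  comm i j hij := by
    by_cases hj : j < n - 1
    · have hi : i < n - 1 := by omega
      refine LinearMap.ext fun f => funext fun v => ?_
      simp only [Module.End.mul_apply, demazureDual_apply hi, demazureDual_apply hj]
      rw [demazureMul_comm v (i := ⟨i, hi⟩) (j := ⟨j, hj⟩) hij]
    · rw [demazureDual_eq_zero (A := A) (not_lt.1 hj)]
      exact Commute.zero_right _
  braid i := by
    by_cases hj : i + 1 < n - 1
    · have hi : i < n - 1 := by omega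
      refine LinearMap.ext fun f => funext fun v => ?_
      simp only [Module.End.mul_apply, demazureDual_apply hi, demazureDual_apply hj]
      rw [demazureMul_braid v (i := ⟨i, hi⟩) (j := ⟨i + 1, hj⟩) rfl]
    · simp [demazureDual_eq_zero (A := A) (not_lt.1 hj)]

/-- A word with a letter outside `S_n` has its Demazure product outside `S_n`, whatever the
permutation it starts from. -/
theorem foldl_demazureMul_ne_embedPerm {Q : List (Fin (n + n - 1))} {k : Fin (n + n - 1)}
    (hk : k ∈ Q) (hnk : n - 1 ≤ k.val) (v : Equiv.Perm (Fin (n + n))) (w : Equiv.Perm (Fin n)) :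
    Q.foldl demazureMul v ≠ embedPerm w := by
  intro h
  obtain ⟨Q₁, Q₂, rfl⟩ := List.append_of_mem hk
  rw [List.foldl_append, List.foldl_cons] at h
  refine not_crossesAt_embedPerm w (k := k.val) (by omega) (h ▸ ?_)
  exact crossesAt_foldl_demazureMul (crossesAt_demazureMul_self _ k) Q₂

/-- A word, applied to the indicator function of `w` and evaluated at `v`, tests whether Demazure
multiplication of `v` by the word results in `w`. -/
theorem prod_demazureDual_single (w : Equiv.Perm (Fin n)) (Q : List (Fin (n + n - 1)))
    (v : Equiv.Perm (Fin n)) :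
    (Q.map fun k => demazureDual A n k.val).prod (Pi.single w 1) v =
      if Q.foldl demazureMul (embedPerm v) = embedPerm w then 1 else 0 := by
  induction Q generalizing v with
  | nil => simp [Pi.single_apply, embedPerm_injective.eq_iff]
  | cons k Q ih =>
    rw [List.map_cons, List.prod_cons, Module.End.mul_apply]
    by_cases hk : k.val < n - 1
    · rw [demazureDual_apply hk, ih, ← embedPerm_demazureMul]
      rfl
    · rw [if_neg (foldl_demazureMul_ne_embedPerm List.mem_cons_self (not_lt.1 hk) _ _),
        demazureDual_eq_zero (not_lt.1 hk)]
      rfl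

theorem demazureDual_single_of_descent {w : Equiv.Perm (Fin n)} {i : Fin (n - 1)}
    (h : w (upperPos i) < w (lowerPos i)) :
    demazureDual A n i.val (Pi.single w 1) =
      Pi.single w 1 + Pi.single (w * simpleReflection i) 1 := by
  funext v
  rw [demazureDual_apply i.isLt]
  have hne : w ≠ w * simpleReflection i := fun h' => by
    have := Equiv.congr_fun h' (lowerPos i)
    rw [mul_simpleReflection_lowerPos] at this
    exact h.ne' this
  simp only [Pi.single_apply, Pi.add_apply]
  rcases apply_lowerPos_lt_or_gt v i with hv | hv
  · have hvw : v ≠ w := by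
      rintro rfl
      exact hv.asymm h
    have hiff : v * simpleReflection i = w ↔ v = w * simpleReflection i :=
      ⟨fun h' => by rw [← h', mul_simpleReflection_mul_self],
        fun h' => by rw [h', mul_simpleReflection_mul_self]⟩
    simp only [demazureMul_of_lt hv, hiff, hvw, if_false, zero_add]
  · have hvw : v ≠ w * simpleReflection i := by
      rintro rfl
      rw [mul_simpleReflection_lowerPos, mul_simpleReflection_upperPos] at hv
      exact hv.asymm h
    simp only [demazureMul_of_gt hv, hvw, if_false, add_zero]

end DemazureDual

/-! ### The sum over subwords -/

section SubwordSum

variable {A B : Type*} [CommRing A] [CommRing B] {n : ℕ}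

/-- The signed sum over the subwords of the square word with Demazure product `w`, in which the box
`(i, j)` has weight `x_i + y_j - x_i y_j`. -/
noncomputable def subwordSum (x y : Fin n → A) (w : Equiv.Perm (Fin n)) : A :=
  ∑ P ∈ subwordsWithProduct w,
    ((P.card : ℤ) - (coxeterLength w : ℤ)).negOnePow •
      ∏ p ∈ P, (x p.1 + y p.2 - x p.1 * y p.2)

theorem negOnePow_sub_smul (a b : ℕ) (z : A) :
    ((a : ℤ) - (b : ℤ)).negOnePow • z = (-1) ^ b * ((-1) ^ a * z) := by
  rw [Int.negOnePow_sub, Units.smul_def, Units.val_mul, zsmul_eq_mul]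
  simp [Int.negOnePow_def, ← mul_assoc, mul_comm]

theorem map_subwordSum (φ : A →+* B) (x y : Fin n → A) (w : Equiv.Perm (Fin n)) :
    φ (subwordSum x y w) = subwordSum (φ ∘ x) (φ ∘ y) w := by
  simp [subwordSum, negOnePow_sub_smul, map_sum, map_prod]

theorem nodup_squareOrder (n : ℕ) : (squareOrder n).Nodup := by
  refine List.nodup_flatMap.2 ⟨fun i _ => ?_, ?_⟩
  · exact (List.nodup_reverse.2 (List.nodup_finRange n)).map fun _ _ h => (Prod.mk.inj h).2
  · refine (List.nodup_finRange n).imp fun hij => ?_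
    intro p hp hp'
    obtain ⟨_, _, rfl⟩ := List.mem_map.1 hp
    obtain ⟨_, _, h⟩ := List.mem_map.1 hp'
    exact hij (Prod.mk.inj h).1.symm

theorem mem_squareOrder (p : Fin n × Fin n) : p ∈ squareOrder n := by
  simp [squareOrder]

/-- A tuple, continued by zero. -/
def extendByZero (x : Fin n → A) (k : ℕ) : A := if h : k < n then x ⟨k, h⟩ else 0

theorem extendByZero_val (x : Fin n → A) (i : Fin n) : extendByZero x i.val = x i := by
  simp [extendByZero]

theorem gridProduct_eq_prod_squareOrder {H : Type*} [Ring H] [Algebra A H] (e : ℕ → H)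
    (x y : Fin n → A) :
    gridProduct e (extendByZero x) (extendByZero y) n n =
      ((squareOrder n).map fun p =>
        1 - (x p.1 + y p.2 - x p.1 * y p.2) • e (p.1.val + p.2.val)).prod := by
  rw [squareOrder, List.map_flatMap, List.flatMap_def, List.prod_flatten, gridProduct,
    List.map_map, ← List.map_coe_finRange_eq_range, List.map_map]
  congr 1
  refine List.map_congr_left fun i _ => ?_
  rw [Function.comp_apply, rowProduct, ← List.map_coe_finRange_eq_range, ← List.map_reverse,
    List.map_map, Function.comp_apply, List.map_map]
  congr 1
  refine List.map_congr_left fun j _ => ?_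
  simp [boxFactor, extendByZero_val]

theorem subwordSum_eq_gridProduct (x y : Fin n → A) (w : Equiv.Perm (Fin n)) :
    subwordSum x y w = (-1) ^ coxeterLength w *
      gridProduct (demazureDual A n) (extendByZero x) (extendByZero y) n n (Pi.single w 1) 1 := by
  rw [gridProduct_eq_prod_squareOrder, list_prod_one_sub_smul
    (fun p : Fin n × Fin n => x p.1 + y p.2 - x p.1 * y p.2)
    (fun p => demazureDual A n (p.1.val + p.2.val)) _ (nodup_squareOrder n)]
  have huniv : (squareOrder n).toFinset = Finset.univ := by
    ext p
    simp [mem_squareOrder]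
  rw [huniv, Finset.powerset_univ, LinearMap.sum_apply, Finset.sum_apply, subwordSum,
    subwordsWithProduct, Finset.sum_filter, Finset.mul_sum]
  refine Finset.sum_congr rfl fun P _ => ?_
  have hword : ((squareOrder n).filter fun p => p ∈ P).map
      (fun p => demazureDual A n (p.1.val + p.2.val)) =
      (squareSubword P).map fun k => demazureDual A n k.val := by
    simp [squareSubword, squareLetter, Function.comp_def]
  rw [LinearMap.smul_apply, Pi.smul_apply, hword, prod_demazureDual_single, embedPerm_one,
    demazureProduct]
  split_ifs
  · rw [negOnePow_sub_smul, smul_eq_mul, mul_one]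
  · rw [smul_zero, mul_zero]

/-- The recurrence for the sums over subwords: in the variables `1 - x_i` it is the defining
equation of the Demazure operator. -/
theorem sub_mul_subwordSum_mul_simpleReflection (x y : Fin n → A) {w : Equiv.Perm (Fin n)}
    {i : Fin (n - 1)} (h : w (upperPos i) < w (lowerPos i)) :
    (x (upperPos i) - x (lowerPos i)) * subwordSum x y (w * simpleReflection i) =
      (1 - x (lowerPos i)) * subwordSum (x ∘ simpleReflection i) y w -
        (1 - x (upperPos i)) * subwordSum x y w := by
  have hi := i.isLt
  have hgrid := gridProduct_mul_exchangeFactor (isDemazureFamily_demazureDual A n)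
    (extendByZero x) (extendByZero y) (i := i.val) (k := n) (J := n) (by omega)
    fun j hj => demazureDual_eq_zero (by omega)
  have hswap : extendByZero x ∘ Equiv.swap i.val (i.val + 1) =
      extendByZero (x ∘ simpleReflection i) := by
    funext k
    by_cases hk : k < n
    · have hval : Equiv.swap i.val (i.val + 1) k = (simpleReflection i ⟨k, hk⟩).val := by
        simp only [simpleReflection, Equiv.swap_apply_def, Fin.ext_iff]
        split_ifs <;> rfl
      rw [Function.comp_apply, hval, extendByZero_val]
      simp [extendByZero, hk]
    · rw [Function.comp_apply, Equiv.swap_apply_of_ne_of_ne (by omega) (by omega)]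
      simp [extendByZero, hk]
  have hlow : extendByZero x i.val = x (lowerPos i) := extendByZero_val x (lowerPos i)
  have hupp : extendByZero x (i.val + 1) = x (upperPos i) := extendByZero_val x (upperPos i)
  rw [hswap, hlow, hupp] at hgrid
  have happ := congrFun (LinearMap.congr_fun hgrid (Pi.single w 1)) 1
  simp only [exchangeFactor, Module.End.mul_apply, LinearMap.sub_apply, LinearMap.smul_apply,
    Module.algebraMap_end_apply, demazureDual_single_of_descent h, map_sub, map_smul, map_add,
    Pi.sub_apply, Pi.smul_apply, Pi.add_apply, smul_eq_mul] at happ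
  simp only [subwordSum_eq_gridProduct]
  rw [coxeterLength_eq_mul_simpleReflection_add_one h, pow_succ]
  linear_combination (-(-1) ^ coxeterLength (w * simpleReflection i)) * happ

end SubwordSum

/-! ### The longest permutation -/

section LongestElement

variable {n : ℕ}

/-- The boxes of the grid that carry a generator of `S_n`. -/
def staircase (n : ℕ) : Finset (Fin n × Fin n) :=
  Finset.univ.filter fun p => (p.1.val + 1) + (p.2.val + 1) ≤ n

theorem coxeterLength_revPerm (n : ℕ) :
    coxeterLength (Fin.revPerm : Equiv.Perm (Fin n)) = (staircase n).card := by
  rw [coxeterLength_eq_card_inversions]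
  -- The box `(i, j)` corresponds to the inversion at the positions `i` and `i + j + 1`.
  refine Finset.card_bij' (fun p _ => (p.1, ⟨p.2.val - p.1.val - 1, by omega⟩))
    (fun p hp => (p.1, ⟨p.1.val + p.2.val + 1, by
      have := (Finset.mem_filter.1 hp).2
      omega⟩)) ?_ ?_ ?_ ?_
  · rintro ⟨a, b⟩ h
    have h := (mem_inversions.1 h).1
    simp only [staircase, Finset.mem_filter, Finset.mem_univ, true_and, Fin.lt_def] at *
    omega
  · rintro ⟨a, b⟩ h
    rw [mem_inversions]
    have hab : a.val < a.val + b.val + 1 := by omega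
    refine ⟨hab, ?_⟩
    rw [Fin.revPerm_apply, Fin.revPerm_apply, Fin.rev_lt_rev]
    exact hab
  · rintro ⟨a, b⟩ h
    have h := (mem_inversions.1 h).1
    simp only [Fin.lt_def] at h
    simp only [Prod.mk.injEq, Fin.ext_iff, true_and]
    omega
  · rintro ⟨a, b⟩ h
    simp only [Prod.mk.injEq, Fin.ext_iff, true_and]
    omega

theorem coxeterLength_le_embedPerm (w : Equiv.Perm (Fin n)) :
    coxeterLength w ≤ coxeterLength (embedPerm w) := by
  rw [coxeterLength_eq_card_inversions, coxeterLength_eq_card_inversions]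
  refine Finset.card_le_card_of_injOn (fun p => (Fin.castAdd n p.1, Fin.castAdd n p.2)) ?_ ?_
  · intro p hp
    have := mem_inversions.1 hp
    rw [Finset.mem_coe, mem_inversions, embedPerm_castAdd, embedPerm_castAdd]
    exact this
  · rintro ⟨a, b⟩ - ⟨c, d⟩ - h
    simpa using h

theorem length_squareSubword (P : Finset (Fin n × Fin n)) :
    (squareSubword P).length = P.card := by
  rw [squareSubword, List.length_map,
    ← List.toFinset_card_of_nodup ((nodup_squareOrder n).filter _)]
  congr 1
  ext p
  simp [mem_squareOrder]

theorem demazureProduct_squareSubword_of_mem {w : Equiv.Perm (Fin n)} {P : Finset (Fin n × Fin n)}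
    (hP : P ∈ subwordsWithProduct w) : demazureProduct (squareSubword P) = embedPerm w :=
  (Finset.mem_filter.1 hP).2

theorem subset_staircase_of_mem_subwordsWithProduct {w : Equiv.Perm (Fin n)}
    {P : Finset (Fin n × Fin n)} (hP : P ∈ subwordsWithProduct w) : P ⊆ staircase n := by
  intro p hp
  simp only [staircase, Finset.mem_filter, Finset.mem_univ, true_and]
  by_contra hcon
  refine foldl_demazureMul_ne_embedPerm (k := squareLetter p) ?_ ?_ 1 w
    (demazureProduct_squareSubword_of_mem hP)
  · exact List.mem_map_of_mem (by simp [hp, mem_squareOrder])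
  · simp only [squareLetter]
    omega

theorem coxeterLength_le_card_of_mem_subwordsWithProduct {w : Equiv.Perm (Fin n)}
    {P : Finset (Fin n × Fin n)} (hP : P ∈ subwordsWithProduct w) :
    coxeterLength w ≤ P.card := by
  rw [← length_squareSubword]
  refine (coxeterLength_le_embedPerm w).trans ?_
  rw [← demazureProduct_squareSubword_of_mem hP]
  exact coxeterLength_demazureProduct_le _

theorem eq_staircase_of_mem_subwordsWithProduct {P : Finset (Fin n × Fin n)}
    (hP : P ∈ subwordsWithProduct (Fin.revPerm : Equiv.Perm (Fin n))) : P = staircase n :=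
  Finset.eq_of_subset_of_card_le (subset_staircase_of_mem_subwordsWithProduct hP)
    (coxeterLength_revPerm n ▸ coxeterLength_le_card_of_mem_subwordsWithProduct hP)

end LongestElement

/-! ### The recurrence of Grothendieck polynomials -/

section Descent

variable {R σ : Type*} [CommRing R]

/-- `oneMinus` as a homomorphism of algebras. -/
noncomputable def oneMinusHom (R σ : Type*) [CommRing R] :
    MvPolynomial σ R →ₐ[R] MvPolynomial σ R :=
  aeval fun v => 1 - X v

theorem oneMinus_eq_oneMinusHom (f : MvPolynomial σ R) : oneMinus f = oneMinusHom R σ f := rfl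

theorem oneMinusHom_X (v : σ) : oneMinusHom R σ (X v) = 1 - X v := by
  simp [oneMinusHom]

theorem oneMinus_oneMinus (f : MvPolynomial σ R) : oneMinus (oneMinus f) = f := by
  have h : (oneMinusHom R σ).comp (oneMinusHom R σ) = AlgHom.id R _ := by
    ext1 v
    simp [oneMinusHom_X]
  exact DFunLike.congr_fun h f

theorem rename_oneMinus (g : σ → σ) (f : MvPolynomial σ R) :
    rename g (oneMinus f) = oneMinus (rename g f) := by
  have h : (rename g).comp (oneMinusHom R σ) = (oneMinusHom R σ).comp (rename g) := by
    ext1 v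
    simp [oneMinusHom_X]
  exact DFunLike.congr_fun h f

variable [DecidableEq σ] {n : ℕ}

theorem exists_demazureDescent (x : Fin n → σ) (top : MvPolynomial σ R)
    (w : Equiv.Perm (Fin n)) : ∃ f, DemazureDescent x top w f := by
  induction hk : Fintype.card (Fin n × Fin n) - coxeterLength w using Nat.strong_induction_on
    generalizing w with
  | _ k ih =>
    by_cases hasc : ∃ i, w (lowerPos i) < w (upperPos i)
    · obtain ⟨i, hi⟩ := hasc
      have hlt := (coxeterLength_lt_mul_simpleReflection_iff w i).2 hi
      have hle : coxeterLength (w * simpleReflection i) ≤ Fintype.card (Fin n × Fin n) := by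
        rw [coxeterLength_eq_card_inversions]
        exact Finset.card_le_univ _
      obtain ⟨f, hf⟩ := ih _ (by omega) (w * simpleReflection i) rfl
      have hstep := DemazureDescent.step _ f i (by rwa [mul_simpleReflection_mul_self]) hf
      rw [mul_simpleReflection_mul_self] at hstep
      exact ⟨_, hstep⟩
    · push Not at hasc
      rw [eq_revPerm_of_forall_upperPos_lt fun i =>
        (apply_lowerPos_lt_or_gt w i).resolve_left (hasc i).not_gt]
      exact ⟨top, .top⟩

/-- The Demazure operators act on the sums over subwords, in the variables `1 - x_i`, by the
recurrence of Grothendieck polynomials. -/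
theorem demazureAt_oneMinus_subwordSum {x : Fin n → σ} (hx : Function.Injective x)
    {y : Fin n → MvPolynomial σ R} {i : Fin (n - 1)}
    (hy : ∀ j, rename (Equiv.swap (x (lowerPos i)) (x (upperPos i))) (y j) = y j)
    {w : Equiv.Perm (Fin n)} (h : w (upperPos i) < w (lowerPos i)) :
    demazureAt x i (oneMinus (subwordSum (fun j => X (x j)) y w)) =
      oneMinus (subwordSum (fun j => X (x j)) y (w * simpleReflection i)) := by
  symm
  refine eq_demazureOperator (hx.ne (lowerPos_ne_upperPos i)) ?_
  change (X (x (upperPos i)) - X (x (lowerPos i))) * _ = X (x (upperPos i)) * _ -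
    X (x (lowerPos i)) * rename (Equiv.swap (x (lowerPos i)) (x (upperPos i))) _
  have hrename : rename (Equiv.swap (x (lowerPos i)) (x (upperPos i)))
      (subwordSum (fun j => X (x j)) y w) =
      subwordSum ((fun j => (X (x j) : MvPolynomial σ R)) ∘ simpleReflection i) y w := by
    have h := map_subwordSum
      (rename (R := R) (Equiv.swap (x (lowerPos i)) (x (upperPos i)))).toRingHom
      (fun j => X (x j)) y w
    refine h.trans ?_
    congr 1
    · funext j
      simp [simpleReflection_eq_swap, hx.map_swap]
    · funext j
      exact hy j
  have hrec := congrArg (oneMinusHom R σ)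
    (sub_mul_subwordSum_mul_simpleReflection (fun j => (X (x j) : MvPolynomial σ R)) y h)
  simp only [map_mul, map_sub, map_one, oneMinusHom_X] at hrec
  rw [rename_oneMinus, hrename]
  simp only [oneMinus_eq_oneMinusHom]
  linear_combination -hrec

theorem eq_oneMinus_subwordSum_of_demazureDescent {x : Fin n → σ} (hx : Function.Injective x)
    {y : Fin n → MvPolynomial σ R}
    (hy : ∀ i j, rename (Equiv.swap (x (lowerPos i)) (x (upperPos i))) (y j) = y j)
    {top : MvPolynomial σ R} (htop : top = oneMinus (subwordSum (fun j => X (x j)) y Fin.revPerm))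
    {w : Equiv.Perm (Fin n)} {f : MvPolynomial σ R} (hf : DemazureDescent x top w f) :
    f = oneMinus (subwordSum (fun j => X (x j)) y w) := by
  induction hf with
  | top => exact htop
  | step w f i hi _ ih =>
    rw [ih]
    exact demazureAt_oneMinus_subwordSum hx (hy i)
      ((coxeterLength_mul_simpleReflection_lt_iff w i).1 hi)

theorem eq_zero_of_demazureDescent_zero {x : Fin n → σ} (hx : Function.Injective x)
    {w : Equiv.Perm (Fin n)} {f : MvPolynomial σ R} (hf : DemazureDescent x 0 w f) : f = 0 := by
  induction hf with
  | top => rfl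
  | step w f i _ _ ih =>
    rw [ih]
    exact (eq_demazureOperator (hx.ne (lowerPos_ne_upperPos i)) (by simp)).symm

/-- If no subword had the longest permutation as its Demazure product, then the recurrence would
make the sums over subwords vanish for every permutation, whereas for the identity the empty
subword contributes a nonzero constant term. -/
theorem subwordsWithProduct_revPerm (n : ℕ) :
    subwordsWithProduct (Fin.revPerm : Equiv.Perm (Fin n)) = {staircase n} := by
  refine Finset.eq_singleton_iff_nonempty_unique_mem.2
    ⟨?_, fun P => eq_staircase_of_mem_subwordsWithProduct⟩
  rw [Finset.nonempty_iff_ne_empty]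
  intro hempty
  obtain ⟨f, hf⟩ := exists_demazureDescent (R := ℤ) (fun i : Fin n => i) 0 1
  have hf0 := eq_zero_of_demazureDescent_zero (fun _ _ h => h) hf
  have hf1 := eq_oneMinus_subwordSum_of_demazureDescent (y := 0) (fun _ _ h => h)
    (fun _ _ => by simp) (by simp [subwordSum, hempty, oneMinus]) hf
  have hzero := congrArg oneMinus (hf0.symm.trans hf1)
  rw [oneMinus_oneMinus] at hzero
  have heval := congrArg (eval (0 : Fin n → ℤ)) hzero
  rw [map_subwordSum, subwordSum_eq_gridProduct, gridProduct_eq_prod_squareOrder] at heval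
  simp [oneMinus] at heval
  exact pow_ne_zero _ (by norm_num) heval.symm

/-- The full staircase is the only subword with the longest permutation as its Demazure product. -/
theorem subwordSum_revPerm {A : Type*} [CommRing A] (x y : Fin n → A) :
    subwordSum x y Fin.revPerm = ∏ p ∈ staircase n, (x p.1 + y p.2 - x p.1 * y p.2) := by
  rw [subwordSum, subwordsWithProduct_revPerm, Finset.sum_singleton, coxeterLength_revPerm,
    sub_self, Int.negOnePow_zero, one_smul]

theorem doubleTop_eq (R : Type*) [CommRing R] (n : ℕ) :
    (∏ p : Fin n × Fin n with (p.1.val + 1) + (p.2.val + 1) ≤ n,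
      (1 - X (Sum.inl p.1) * X (Sum.inr p.2)) : MvPolynomial (Fin n ⊕ Fin n) R) =
    oneMinus (subwordSum (fun j => X (Sum.inl j)) (fun j => X (Sum.inr j)) Fin.revPerm) := by
  rw [subwordSum_revPerm, oneMinus_eq_oneMinusHom, map_prod]
  refine Finset.prod_congr rfl fun p _ => ?_
  simp only [map_sub, map_add, map_mul, oneMinusHom_X]
  ring

theorem singleTop_eq (R : Type*) [CommRing R] (n : ℕ) :
    (∏ i : Fin n, (1 - X i) ^ (n - (i.val + 1)) : MvPolynomial (Fin n) R) =
    oneMinus (subwordSum (fun j => X j) (fun _ => 0) Fin.revPerm) := by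
  rw [subwordSum_revPerm, oneMinus_eq_oneMinusHom, map_prod, staircase, Finset.prod_filter,
    Fintype.prod_prod_type]
  refine Finset.prod_congr rfl fun i _ => ?_
  simp only [add_zero, mul_zero, sub_zero, oneMinusHom_X]
  rw [← Finset.prod_filter, Finset.prod_const]
  congr 1
  have h : (Finset.univ.filter fun j : Fin n => (i.val + 1) + (j.val + 1) ≤ n) =
      Finset.univ.filter fun j : Fin n => j.val < n - (i.val + 1) := by
    ext j
    simp only [Finset.mem_filter, Finset.mem_univ, true_and]
    omega
  rw [h, Fin.card_filter_val_lt]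
  omega

end Descent

theorem mainTheorem5 (R : Type*) [CommRing R] (n : ℕ) (w : Equiv.Perm (Fin n)) :
    ((∃! G : MvPolynomial (Fin n ⊕ Fin n) R, IsDoubleGrothendieck w G) ∧
      ∀ G : MvPolynomial (Fin n ⊕ Fin n) R, IsDoubleGrothendieck w G →
        oneMinus G =
          ∑ P ∈ subwordsWithProduct w,
            ((P.card : ℤ) - (coxeterLength w : ℤ)).negOnePow •
              ∏ p ∈ P,
                (X (Sum.inl p.1) + X (Sum.inr p.2) - X (Sum.inl p.1) * X (Sum.inr p.2))) ∧
    ((∃! G : MvPolynomial (Fin n) R, IsGrothendieck w G) ∧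
      ∀ G : MvPolynomial (Fin n) R, IsGrothendieck w G →
        oneMinus G =
          ∑ P ∈ subwordsWithProduct w,
            ((P.card : ℤ) - (coxeterLength w : ℤ)).negOnePow • ∏ p ∈ P, X p.1) := by
  have hdouble : ∀ G : MvPolynomial (Fin n ⊕ Fin n) R, IsDoubleGrothendieck w G →
      G = oneMinus (subwordSum (fun j => X (Sum.inl j)) (fun j => X (Sum.inr j)) w) :=
    fun G hG => eq_oneMinus_subwordSum_of_demazureDescent Sum.inl_injective
      (fun i j => by rw [rename_X, Equiv.swap_apply_of_ne_of_ne] <;> simp) (doubleTop_eq R n) hG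
  have hsingle : ∀ G : MvPolynomial (Fin n) R, IsGrothendieck w G →
      G = oneMinus (subwordSum (fun j => X j) (fun _ => 0) w) :=
    fun G hG => eq_oneMinus_subwordSum_of_demazureDescent (fun _ _ h => h)
      (fun _ _ => map_zero _) (singleTop_eq R n) hG
  refine ⟨⟨?_, fun G hG => ?_⟩, ⟨?_, fun G hG => ?_⟩⟩
  · obtain ⟨G, hG⟩ := exists_demazureDescent (R := R) (Sum.inl : Fin n → Fin n ⊕ Fin n) _ w
    exact ⟨G, hG, fun G' hG' => (hdouble G' hG').trans (hdouble G hG).symm⟩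
  · rw [hdouble G hG, oneMinus_oneMinus, subwordSum]
  · obtain ⟨G, hG⟩ := exists_demazureDescent (R := R) (fun i => i) _ w
    exact ⟨G, hG, fun G' hG' => (hsingle G' hG').trans (hsingle G hG).symm⟩
  · rw [hsingle G hG, oneMinus_oneMinus, subwordSum]
    simp
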